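/- **Setting.** Let $\mathcal S$ be a bounded metric space, $\mathcal A$ a metric space, and $\mathcal C$ an open convex subset of a real Banach space; products of metric spaces carry the maximum metric. Let $\mathrm{Meas}(\mathcal S)$ be the space of finite signed Borel measures on $\mathcal S$ with the total variation norm $\|\mu\|=\mu^+(\mathcal S)+\mu^-(\mathcal S)$, where $\mu=\mu^+-\mu^-$ is the Jordan decomposition. For $p\in[1,\infty]$ let $\mathcal W_p(\mathcal A)$ be the set of Borel probability measures on $\mathcal A$ with the Wasserstein distance $W_p$ (with $W_\infty=\lim_{q\to\infty}W_q$). $L_f$ denotes the best Lipschitz constant of a map $f$, $\|f\|_\infty$ the supremum of $\|f\|$ over the domain of $f$, and $\|f\|_{\mathrm{Lip}}=\max(\|f\|_\infty,L_f)$; $\mathrm{Lip}(\mathcal S\times\mathcal A)$ is the space of bounded Lipschitz functions $\mathcal S\times\mathcal A\to\mathbb R$. Let $\mathcal T:\mathcal S\times\mathcal A\times\mathcal C\to\mathrm{Meas}(\mathcal S)$, $(s,a,c)\mapsto\mathcal T^c(s,a)$, take values in the probability measures, and let $R:\mathcal S\times\mathcal A\times\mathcal C\to\mathbb R$, $(s,a,c)\mapsto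 R^c(s,a)$. Assume that $\mathcal T$ and $R$ are twice continuously differentiable in $c$ for each fixed $(s,a)$; that $\partial_c\mathcal T,\ \partial_c^2\mathcal T,\ R,\ \partial_cR,\ \partial_c^2R$ are bounded; and that $\mathcal T,\ \partial_c\mathcal T,\ R,\ \partial_cR$ are Lipschitz on $\mathcal S\times\mathcal A\times\mathcal C$ (derivatives are measured in operator norm, and $L_{\mathcal T}$ is taken with respect to the total variation norm). Let $\pi:\mathcal S\times\mathcal C\to\mathcal W_p(\mathcal A)$ be Lipschitz with constant $L_\pi$. For $\gamma\in[0,1)$, a reward $r$ and transitions $K$ on $\mathcal S\times\mathcal A$, consider the Bellman equation in context $c$, $$Q(s,a)=r(s,a)+\gamma\int_{\mathcal S}\int_{\mathcal A}Q(s',a')\,d\pi(s',c)(a')\,dK(s,a)(s').$$ **Theorem.** Let $c_0,c\in\mathcal C$ and $\gamma\in[0,1)$ satisfy $$\|c-c_0\|<\|\partial_c^2\mathcal T\|_\infty^{-1/2},\qquad \gamma<\frac{1}{4\,\mathrm{diam}(\mathcal S)\,(L_{\mathcal T}+\|c-c_0\|L_{\partial_c\mathcal T})(1+L_\pi)},$$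 where a right-hand side with vanishing denominator is read as $+\infty$. Put $$\widehat{\mathcal T}(s,a)=\mathcal T^{c_0}(s,a)+\partial_c\mathcal T^{c_0}(s,a)\cdot(c-c_0),\quad \mathcal T^c_{ce}(s,a)=P(\widehat{\mathcal T}(s,a)),\quad R^c_{ce}=R^{c_0}+\partial_cR^{c_0}\cdot(c-c_0),$$ with $P(\mu)=\mu^+/\|\mu^+\|$. Then $\widehat{\mathcal T}(s,a)^+\ne 0$ for all $(s,a)$, so $\mathcal T^c_{ce}$ is well defined; the Bellman equations in context $c$ for $(R^c,\mathcal T^c)$ and for $(R^c_{ce},\mathcal T^c_{ce})$ have unique solutions $Q^c_{be}$ and $Q^c_{ce}$ in $\mathrm{Lip}(\mathcal S\times\mathcal A)$; and $$\|Q^c_{ce}-Q^c_{be}\|_\infty\le\frac{\|c-c_0\|^2}{1-\gamma}\left(\|\partial_c^2R\|_\infty+\frac{3\gamma\,\mathrm{diam}(\mathcal S)(1+L_\pi)\,\|R\|_{\mathrm{Lip}(\mathcal S\times\mathcal A\times\mathcal C)}\,\|\partial_c^2\mathcal T\|_\infty}{1-\gamma\max\big(1,\mathrm{diam}(\mathcal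 S)L_{\mathcal T}(1+L_\pi)\big)}\right).$$ -/

import Mathlib

open MeasureTheory Set
open scoped ENNReal NNReal

noncomputable section

namespace CEBE

/-! ### Finite signed measures with the total variation norm -/

section TotalVariation

variable {X : Type*} [MeasurableSpace X]

/-- The total variation norm `‖μ‖ = |μ|(X) = μ⁺(X) + μ⁻(X)` of a finite signed measure. -/
def tvNorm (μ : SignedMeasure X) : ℝ := μ.totalVariation.real univ

theorem tvNorm_eq (μ : SignedMeasure X) :
    tvNorm μ = μ.toJordanDecomposition.posPart.real univ +
      μ.toJordanDecomposition.negPart.real univ := by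
  rw [tvNorm, SignedMeasure.totalVariation, measureReal_add_apply]

theorem tvNorm_zero : tvNorm (0 : SignedMeasure X) = 0 := by
  simp [tvNorm, SignedMeasure.totalVariation_zero]

theorem tvNorm_neg (μ : SignedMeasure X) : tvNorm (-μ) = tvNorm μ := by
  simp [tvNorm, SignedMeasure.totalVariation_neg]

theorem tvNorm_add_le (μ ν : SignedMeasure X) : tvNorm (μ + ν) ≤ tvNorm μ + tvNorm ν := by
  have h : (μ + ν).totalVariation ≤ μ.totalVariation + ν.totalVariation := by
    simp only [SignedMeasure.totalVariation_eq_variation]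
    exact VectorMeasure.variation_add_le
  rw [tvNorm, tvNorm, tvNorm, ← measureReal_add_apply]
  exact ENNReal.toReal_mono (measure_ne_top _ _) (h univ)

theorem tvNorm_smul (r : ℝ) (μ : SignedMeasure X) : tvNorm (r • μ) = |r| * tvNorm μ := by
  rw [tvNorm_eq, tvNorm_eq, SignedMeasure.toJordanDecomposition_smul_real]
  rcases le_or_gt 0 r with hr | hr
  · rw [JordanDecomposition.real_smul_posPart_nonneg _ _ hr,
      JordanDecomposition.real_smul_negPart_nonneg _ _ hr,
      measureReal_nnreal_smul_apply, measureReal_nnreal_smul_apply,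
      Real.coe_toNNReal _ hr, abs_of_nonneg hr]
    ring
  · rw [JordanDecomposition.real_smul_posPart_neg _ _ hr,
      JordanDecomposition.real_smul_negPart_neg _ _ hr,
      measureReal_nnreal_smul_apply, measureReal_nnreal_smul_apply,
      Real.coe_toNNReal _ (by linarith), abs_of_neg hr]
    ring

theorem eq_zero_of_tvNorm_eq_zero (μ : SignedMeasure X) (h : tvNorm μ = 0) : μ = 0 := by
  ext i _
  have h1 := SignedMeasure.norm_le_totalVariation μ i
  have h2 : μ.totalVariation.real i ≤ μ.totalVariation.real univ :=
    measureReal_mono (subset_univ i)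
  have h3 : ‖μ i‖ ≤ 0 := h1.trans (h2.trans h.le)
  simpa using h3

/-- The finite signed measures on `X`, normed by total variation. -/
instance instNormedAddCommGroupSignedMeasure : NormedAddCommGroup (SignedMeasure X) :=
  AddGroupNorm.toNormedAddCommGroup
    { toFun := tvNorm
      map_zero' := tvNorm_zero
      add_le' := tvNorm_add_le
      neg' := tvNorm_neg
      eq_zero_of_map_eq_zero' := eq_zero_of_tvNorm_eq_zero }

instance instNormedSpaceSignedMeasure : NormedSpace ℝ (SignedMeasure X) where
  norm_smul_le r μ := (tvNorm_smul r μ).le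

/-- The signed measure `μ` is a probability measure. -/
def IsProbability (μ : SignedMeasure X) : Prop := 0 ≤ μ ∧ μ univ = 1

/-- The projection `P(μ) = μ⁺ / ‖μ⁺‖` to the probability simplex. It is meaningful for signed
measures with `μ⁺(X) > 0`. -/
def simplexProj (μ : SignedMeasure X) : SignedMeasure X :=
  (μ.toJordanDecomposition.posPart.real univ)⁻¹ •
    μ.toJordanDecomposition.posPart.toSignedMeasure

end TotalVariation

/-! ### Sup norms, Lipschitz constants, Lipschitz norms -/

section Norms

/-- `f` is bounded on `s`. -/
def IsBoundedOn {X V : Type*} [Norm V] (f : X → V) (s : Set X) : Prop :=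
  ∃ B : ℝ, ∀ x ∈ s, ‖f x‖ ≤ B

/-- The sup norm `‖f‖_∞` over the set `s`. -/
def supNormOn {X V : Type*} [Norm V] (f : X → V) (s : Set X) : ℝ :=
  ⨆ x : s, ‖f x‖

variable {X Y : Type*} [PseudoEMetricSpace X] [PseudoEMetricSpace Y]

/-- `f` is Lipschitz on `s`. -/
def IsLipschitzOn (f : X → Y) (s : Set X) : Prop :=
  ∃ K : ℝ≥0, LipschitzOnWith K f s

/-- The (best) Lipschitz constant `L_f` of `f` on `s`. -/
def lipConstOn (f : X → Y) (s : Set X) : ℝ≥0 :=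
  sInf {K : ℝ≥0 | LipschitzOnWith K f s}

/-- The norm `max (sup |f|, L_f)` of the space of bounded Lipschitz functions on `s`. -/
def lipNormOn (f : X → ℝ) (s : Set X) : ℝ :=
  max (supNormOn f s) (lipConstOn f s)

end Norms

/-! ### Wasserstein distances and Lipschitz policies -/

section Wasserstein

variable {X : Type*} [MetricSpace X] [MeasurableSpace X]

/-- Couplings of `μ` and `ν`: Borel measures on `X × X` with marginals `μ` and `ν`.
The Borel `σ`-algebra of `X × X` makes the distance measurable; it is the product `σ`-algebra
when `X` is separable. -/
def IsCoupling (μ ν : Measure X) (Γ : @Measure (X × X) (borel (X × X))) : Prop :=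
  @Measure.map _ _ (borel (X × X)) _ Prod.fst Γ = μ ∧
    @Measure.map _ _ (borel (X × X)) _ Prod.snd Γ = ν

/-- `W_q(μ, ν) = inf_Γ (∫ d(x, y)^q dΓ)^{1/q}` for real `q ≥ 1`, with values in `[0, ∞]`. -/
def wassersteinReal (q : ℝ) (μ ν : Measure X) : ℝ≥0∞ :=
  ⨅ (Γ : @Measure (X × X) (borel (X × X))) (_ : IsCoupling μ ν Γ),
    (@lintegral _ (borel (X × X)) Γ fun z => edist z.1 z.2 ^ q) ^ (1 / q)

/-- `W_p(μ, ν)` for `p ∈ [1, ∞]`, where `W_∞ = lim_{q → ∞} W_q`; as `q ↦ W_q` is nondecreasing on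
`[1, ∞)` for probability measures, the limit is the supremum. -/
def wasserstein (p : ℝ≥0∞) (μ ν : Measure X) : ℝ≥0∞ :=
  if p = ∞ then ⨆ (q : ℝ) (_ : 1 ≤ q), wassersteinReal q μ ν
  else wassersteinReal p.toReal μ ν

variable {S E : Type*} [PseudoEMetricSpace S] [PseudoEMetricSpace E]

/-- The policy `π : S × C → W_p(X)` is Lipschitz with constant `K`. -/
def PolicyLipschitzWith (p : ℝ≥0∞) (C : Set E) (K : ℝ≥0)
    (π : S × E → ProbabilityMeasure X) : Prop :=
  ∀ (s s' : S), ∀ c ∈ C, ∀ c' ∈ C,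
    wasserstein p (π (s, c) : Measure X) (π (s', c') : Measure X) ≤
      K * edist (s, c) (s', c')

/-- The (best) Lipschitz constant `L_π` of a policy `π : S × C → W_p(X)`. -/
def policyLipConst (p : ℝ≥0∞) (C : Set E) (π : S × E → ProbabilityMeasure X) : ℝ≥0 :=
  sInf {K : ℝ≥0 | PolicyLipschitzWith p C K π}

end Wasserstein

/-! ### Contexts: slices, partial derivatives, linearization -/

section Context

variable {S A E F : Type*}

/-- The set `S × A × C`. -/
def dom (S A : Type*) {E : Type*} (C : Set E) : Set (S × A × E) := {z | z.2.2 ∈ C}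

/-- The slice `f^c : S × A → F`. -/
def slice (f : S × A × E → F) (c : E) : S × A → F := fun z => f (z.1, z.2, c)

variable [NormedAddCommGroup E] [NormedSpace ℝ E] [NormedAddCommGroup F] [NormedSpace ℝ F]

/-- The partial derivative `∂_c f`. The second derivative `∂²_c f` is `partialC (partialC f)`. -/
def partialC (f : S × A × E → F) : S × A × E → (E →L[ℝ] F) :=
  fun z => fderiv ℝ (fun c => f (z.1, z.2.1, c)) z.2.2

/-- The linearization `f^{c₀} + ∂_c f^{c₀} · (c - c₀)`. -/
def linearize (f : S × A × E → F) (c₀ c : E) : S × A → F :=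
  fun z => f (z.1, z.2, c₀) + partialC f (z.1, z.2, c₀) (c - c₀)

/-- `f` is twice continuously differentiable in the context `c ∈ C`. -/
def IsC2InContext (f : S × A × E → F) (C : Set E) : Prop :=
  ∀ (s : S) (a : A), ContDiffOn ℝ 2 (fun c => f (s, a, c)) C

end Context

/-! ### The Bellman equation -/

section Bellman

variable {S A : Type*} [MetricSpace S] [MeasurableSpace S] [MetricSpace A] [MeasurableSpace A]

/-- `(A^{K, π} Q)(s, a) = ∫_S ∫_A Q(s', a') dπ_{s'}(a') dK_{s, a}(s')`. -/
def bellmanOp (K : S × A → SignedMeasure S) (π : S → ProbabilityMeasure A) (Q : S × A → ℝ) :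
    S × A → ℝ :=
  fun z => ∫ᵛ s', (∫ a', Q (s', a') ∂(π s' : Measure A)) ∂<•(K z)

/-- `Q` is a `Q`-function for the reward `r`, the transitions `K`, the policy `π` and the discount
factor `γ`: a bounded Lipschitz solution of the Bellman equation `Q = r + γ A^{K, π} Q`. -/
structure IsQFunction (γ : ℝ) (r : S × A → ℝ) (K : S × A → SignedMeasure S)
    (π : S → ProbabilityMeasure A) (Q : S × A → ℝ) : Prop where
  bounded : IsBoundedOn Q univ
  lipschitz : IsLipschitzOn Q univ
  bellman : ∀ z, Q z = r z + γ * bellmanOp K π Q z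

end Bellman

end CEBE

end

/-!
Linearising in the context changes rewards and transitions by at most `M * ‖c - c₀‖ ^ 2`, with `M`
a bound on the second derivative. The linearised transitions still have total mass one, and on such
measures the projection `P` is 2-Lipschitz and lands within three times the original distance of any
given probability measure.

For a Lipschitz probability kernel the Bellman operator is a `γ`-contraction on bounded functions,
and it maps bounded functions to Lipschitz ones, so its fixed point is Lipschitz for every `γ < 1`.

Averaging `Q` over actions gives a function of the state with Lipschitz constant `L_Q * (1 + L_π)`,
whose oscillation is therefore at most `diam S * L_Q * (1 + L_π)`. Differences of probability
measures annihilate constants, so only this oscillation matters. It controls both the effect of an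
error in the transitions on the Bellman equation and, when `γ * diam S * L_T * (1 + L_π) < 1`, the
Lipschitz constant of the solution.
-/

namespace CEBE

open scoped BoundedContinuousFunction

section Normalize

open NormedSpace

variable {V : Type*} [NormedAddCommGroup V] [NormedSpace ℝ V]

theorem norm_normalize_sub_normalize_le {u : V} (hu : 1 ≤ ‖u‖) (v : V) :
    ‖normalize u - normalize v‖ ≤ 2 * ‖u - v‖ := by
  have hsub : normalize u - normalize v = ‖u‖⁻¹ • ((u - v) + (‖v‖ - ‖u‖) • normalize v) := by
    rw [sub_smul, norm_smul_normalize, sub_add_sub_cancel, smul_sub,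
      inv_smul_smul₀ (by positivity), NormedSpace.normalize]
  have hv : |‖v‖ - ‖u‖| * ‖normalize v‖ ≤ ‖u - v‖ := by
    rw [norm_sub_rev]
    refine (mul_le_of_le_one_right (abs_nonneg _) ?_).trans (abs_norm_sub_norm_le v u)
    rw [NormedSpace.normalize, norm_smul, norm_inv, norm_norm]
    exact inv_mul_le_one
  calc ‖normalize u - normalize v‖
      ≤ ‖u‖⁻¹ * (‖u - v‖ + |‖v‖ - ‖u‖| * ‖normalize v‖) := by
        rw [hsub, norm_smul, norm_inv, norm_norm, ← Real.norm_eq_abs, ← norm_smul]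
        gcongr
        exact norm_add_le _ _
    _ ≤ 1 * (‖u - v‖ + ‖u - v‖) := by
        gcongr
        exact inv_le_one_of_one_le₀ hu
    _ = 2 * ‖u - v‖ := by ring

end Normalize

section TotalVariation

variable {X : Type*} [MeasurableSpace X]

theorem norm_eq_variation_real_univ (μ : SignedMeasure X) : ‖μ‖ = μ.variation.real univ := by
  rw [← SignedMeasure.totalVariation_eq_variation]
  rfl

theorem norm_toSignedMeasure (ν : Measure X) [IsFiniteMeasure ν] :
    ‖ν.toSignedMeasure‖ = ν.real univ := by
  rw [norm_eq_variation_real_univ, Measure.variation_toSignedMeasure]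

theorem abs_apply_le_norm (μ : SignedMeasure X) (i : Set X) : |μ i| ≤ ‖μ‖ :=
  (SignedMeasure.norm_le_totalVariation μ i).trans (measureReal_mono (subset_univ i))

theorem norm_le_of_forall_abs_apply_le {μ : SignedMeasure X} {ν : Measure X} [IsFiniteMeasure ν]
    (h : ∀ i, MeasurableSet i → |μ i| ≤ ν.real i) : ‖μ‖ ≤ ν.real univ := by
  rw [norm_eq_variation_real_univ]
  refine ENNReal.toReal_mono (measure_ne_top _ _)
    (VectorMeasure.variation_le_of_forall_enorm_le (m := ν) (fun i hi => ?_) univ)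
  rw [Real.enorm_eq_ofReal_abs, ← ofReal_measureReal]
  exact ENNReal.ofReal_le_ofReal (h i hi)

theorem norm_eq_apply_univ_of_nonneg {μ : SignedMeasure X} (hμ : 0 ≤ μ) : ‖μ‖ = μ univ := by
  have hμ' : 0 ≤[univ] μ := (VectorMeasure.le_restrict_univ_iff_le _ _).2 hμ
  rw [← SignedMeasure.toMeasureOfZeroLE_toSignedMeasure μ hμ', norm_toSignedMeasure,
    Measure.toSignedMeasure_apply_measurable .univ]

theorem IsProbability.norm_eq_one {μ : SignedMeasure X} (hμ : IsProbability μ) : ‖μ‖ = 1 := by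
  rw [norm_eq_apply_univ_of_nonneg hμ.1, hμ.2]

theorem posPart_real_le_add (μ ν : SignedMeasure X) {i : Set X} (hi : MeasurableSet i) :
    μ.toJordanDecomposition.posPart.real i ≤
      ν.toJordanDecomposition.posPart.real i + (μ - ν).totalVariation.real i := by
  obtain ⟨P, hP, _, _, hpos, _⟩ := μ.toJordanDecomposition_spec
  calc μ.toJordanDecomposition.posPart.real i
      = ν (P ∩ i) + (μ - ν) (P ∩ i) := by
        rw [hpos, SignedMeasure.toMeasureOfZeroLE_real_apply _ _ _ hi, _root_.sub_apply]
        ring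
    _ ≤ ν.toJordanDecomposition.posPart.real (P ∩ i) + (μ - ν).totalVariation.real (P ∩ i) := by
        gcongr
        · rw [ν.apply_eq_posPart_real_sub_negPart_real (hP.inter hi)]
          exact sub_le_self _ measureReal_nonneg
        · exact (le_abs_self _).trans (SignedMeasure.norm_le_totalVariation _ _)
    _ ≤ ν.toJordanDecomposition.posPart.real i + (μ - ν).totalVariation.real i := by
        exact add_le_add (measureReal_mono inter_subset_right)
          (measureReal_mono inter_subset_right)

theorem norm_posPart_sub_posPart_le (μ ν : SignedMeasure X) :
    ‖μ.toJordanDecomposition.posPart.toSignedMeasure -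
      ν.toJordanDecomposition.posPart.toSignedMeasure‖ ≤ ‖μ - ν‖ := by
  refine norm_le_of_forall_abs_apply_le (ν := (μ - ν).totalVariation) fun i hi => ?_
  rw [Measure.toSignedMeasure_sub_apply hi, abs_sub_le_iff]
  have hνμ := posPart_real_le_add ν μ hi
  rw [← neg_sub μ ν, SignedMeasure.totalVariation_neg] at hνμ
  exact ⟨sub_le_iff_le_add'.2 (posPart_real_le_add μ ν hi), sub_le_iff_le_add'.2 hνμ⟩

theorem negPart_real_univ_le_norm_sub {μ ν : SignedMeasure X} (hν : 0 ≤ ν) :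
    μ.toJordanDecomposition.negPart.real univ ≤ ‖μ - ν‖ := by
  obtain ⟨P, hP, _, _, _, hneg⟩ := μ.toJordanDecomposition_spec
  rw [hneg, SignedMeasure.toMeasureOfLEZero_real_apply _ _ _ .univ, inter_univ]
  calc -μ Pᶜ ≤ -μ Pᶜ + ν Pᶜ := le_add_of_nonneg_right (hν _ hP.compl)
    _ = -(μ - ν) Pᶜ := by rw [_root_.sub_apply]; ring
    _ ≤ ‖μ - ν‖ := (neg_le_abs _).trans (abs_apply_le_norm _ _)

theorem posPart_real_univ_eq {μ : SignedMeasure X} (hμ : μ univ = 1) :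
    μ.toJordanDecomposition.posPart.real univ =
      1 + μ.toJordanDecomposition.negPart.real univ := by
  rw [← hμ, μ.apply_eq_posPart_real_sub_negPart_real .univ, sub_add_cancel]

theorem one_le_posPart_real_univ {μ : SignedMeasure X} (hμ : μ univ = 1) :
    1 ≤ μ.toJordanDecomposition.posPart.real univ := by
  rw [posPart_real_univ_eq hμ]
  exact le_add_of_nonneg_right measureReal_nonneg

theorem posPart_univ_pos {μ : SignedMeasure X} (hμ : μ univ = 1) :
    0 < μ.toJordanDecomposition.posPart univ :=
  (ENNReal.toReal_pos_iff.1 (one_pos.trans_le (one_le_posPart_real_univ hμ))).1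

theorem isProbability_simplexProj {μ : SignedMeasure X} (hμ : μ univ = 1) :
    IsProbability (simplexProj μ) := by
  have hmass := one_le_posPart_real_univ hμ
  refine ⟨fun i hi => ?_, ?_⟩
  · rw [simplexProj, _root_.smul_apply, Measure.toSignedMeasure_apply_measurable hi]
    exact smul_nonneg (by positivity) measureReal_nonneg
  · rw [simplexProj, _root_.smul_apply, Measure.toSignedMeasure_apply_measurable .univ,
      smul_eq_mul, inv_mul_cancel₀ (by linarith)]

theorem simplexProj_eq_normalize (μ : SignedMeasure X) :
    simplexProj μ = NormedSpace.normalize μ.toJordanDecomposition.posPart.toSignedMeasure := by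
  rw [NormedSpace.normalize, norm_toSignedMeasure, simplexProj]

theorem lipschitzOnWith_simplexProj :
    LipschitzOnWith 2 (simplexProj (X := X)) {μ | μ univ = 1} := by
  refine LipschitzOnWith.of_dist_le_mul fun μ hμ ν _ => ?_
  rw [dist_eq_norm, dist_eq_norm, simplexProj_eq_normalize, simplexProj_eq_normalize]
  calc _ ≤ 2 * ‖μ.toJordanDecomposition.posPart.toSignedMeasure -
          ν.toJordanDecomposition.posPart.toSignedMeasure‖ :=
        norm_normalize_sub_normalize_le
          ((one_le_posPart_real_univ hμ).trans_eq (norm_toSignedMeasure _).symm) _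
    _ ≤ 2 * ‖μ - ν‖ := by gcongr; exact norm_posPart_sub_posPart_le μ ν

theorem lipschitzWith_simplexProj_comp {Y : Type*} [PseudoEMetricSpace Y] {K : Y → SignedMeasure X}
    (hK : ∀ y, K y univ = 1) {L : ℝ≥0} (hL : LipschitzWith L K) :
    LipschitzWith (2 * L) fun y => simplexProj (K y) :=
  lipschitzOnWith_univ.1 <|
    lipschitzOnWith_simplexProj.comp (lipschitzOnWith_univ.2 hL) fun y _ => hK y

theorem norm_simplexProj_sub_self_le {μ : SignedMeasure X} (hμ : μ univ = 1) :
    ‖simplexProj μ - μ‖ ≤ 2 * μ.toJordanDecomposition.negPart.real univ := by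
  set j := μ.toJordanDecomposition
  have hm : j.posPart.real univ = 1 + j.negPart.real univ := posPart_real_univ_eq hμ
  have hneg : 0 ≤ j.negPart.real univ := measureReal_nonneg
  have hdecomp : simplexProj μ - μ =
      ((j.posPart.real univ)⁻¹ - 1) • j.posPart.toSignedMeasure + j.negPart.toSignedMeasure := by
    nth_rw 2 [← μ.toSignedMeasure_toJordanDecomposition]
    rw [simplexProj, JordanDecomposition.toSignedMeasure, sub_smul, one_smul]
    abel
  have hscale : |(j.posPart.real univ)⁻¹ - 1| * j.posPart.real univ = j.negPart.real univ := by
    rw [hm, abs_of_nonpos (sub_nonpos.2 (inv_le_one_of_one_le₀ (by linarith)))]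
    field_simp
    ring
  calc ‖simplexProj μ - μ‖
      ≤ |(j.posPart.real univ)⁻¹ - 1| * j.posPart.real univ + j.negPart.real univ := by
        rw [hdecomp, ← norm_toSignedMeasure, ← norm_toSignedMeasure, ← Real.norm_eq_abs,
          ← norm_smul]
        exact norm_add_le _ _
    _ = 2 * j.negPart.real univ := by rw [hscale, two_mul]

theorem norm_simplexProj_sub_le {μ ν : SignedMeasure X} (hμ : μ univ = 1) (hν : 0 ≤ ν) :
    ‖simplexProj μ - ν‖ ≤ 3 * ‖μ - ν‖ :=
  calc ‖simplexProj μ - ν‖ ≤ ‖simplexProj μ - μ‖ + ‖μ - ν‖ := norm_sub_le_norm_sub_add_norm_sub ..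
    _ ≤ 2 * ‖μ - ν‖ + ‖μ - ν‖ := by
        gcongr
        exact (norm_simplexProj_sub_self_le hμ).trans
          (by gcongr; exact negPart_real_univ_le_norm_sub hν)
    _ = 3 * ‖μ - ν‖ := by ring

end TotalVariation

section Integral

variable {X : Type*} [MeasurableSpace X]

instance isFiniteMeasure_variation (μ : SignedMeasure X) : IsFiniteMeasure μ.variation := by
  rw [← SignedMeasure.totalVariation_eq_variation]
  infer_instance

theorem integrable_of_abs_le (μ : SignedMeasure X) {f : X → ℝ} (hf : Measurable f) {B : ℝ}
    (hB : ∀ x, |f x| ≤ B) : μ.Integrable f :=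
  Integrable.of_bound hf.aestronglyMeasurable B (.of_forall hB)

theorem abs_integral_le (μ : SignedMeasure X) {f : X → ℝ} {B : ℝ} (hB : ∀ x, |f x| ≤ B) :
    |∫ᵛ x, f x ∂<•μ| ≤ B * ‖μ‖ := by
  rcases isEmpty_or_nonempty X with _ | ⟨⟨x₀⟩⟩
  · have hμ : μ = 0 := by ext i _; simp [eq_empty_of_isEmpty i]
    simp [hμ]
  have hB₀ : 0 ≤ B := (abs_nonneg _).trans (hB x₀)
  have hflip : ‖(ContinuousLinearMap.lsmul ℝ ℝ : ℝ →L[ℝ] ℝ →L[ℝ] ℝ).flip‖ ≤ 1 := by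
    rw [ContinuousLinearMap.opNorm_flip]
    exact ContinuousLinearMap.opNorm_lsmul_le
  have hint := VectorMeasure.norm_integral_le_of_norm_le_const (μ := μ)
    (B := (ContinuousLinearMap.lsmul ℝ ℝ : ℝ →L[ℝ] ℝ →L[ℝ] ℝ).flip) (f := f) (.of_forall hB)
  rw [← norm_eq_variation_real_univ] at hint
  refine hint.trans ?_
  gcongr
  exact mul_le_of_le_one_right hB₀ hflip

theorem abs_integral_le_of_apply_univ_eq_zero {μ : SignedMeasure X} (hμ : μ univ = 0) {f : X → ℝ}
    (hf : Measurable f) {B : ℝ} (hB : ∀ x y, |f x - f y| ≤ B) :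
    |∫ᵛ x, f x ∂<•μ| ≤ B * ‖μ‖ := by
  rcases isEmpty_or_nonempty X with hX | ⟨⟨x₀⟩⟩
  · exact abs_integral_le μ hX.elim
  have hcenter : ∫ᵛ x, f x ∂<•μ = ∫ᵛ x, (f x - f x₀) ∂<•μ := by
    have hsum := VectorMeasure.integral_fun_add (μ := μ)
      (B := (ContinuousLinearMap.lsmul ℝ ℝ : ℝ →L[ℝ] ℝ →L[ℝ] ℝ).flip)
      (integrable_of_abs_le μ (hf.sub_const _) (hB · x₀)) (integrable_const (f x₀))
    simpa only [sub_add_cancel, VectorMeasure.integral_const, hμ, map_zero, add_zero] using hsum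
  rw [hcenter]
  exact abs_integral_le μ (hB · x₀)

theorem abs_integral_sub_integral_le (μ ν : SignedMeasure X) {f : X → ℝ} (hf : Measurable f)
    {B : ℝ} (hB : ∀ x, |f x| ≤ B) : |∫ᵛ x, f x ∂<•μ - ∫ᵛ x, f x ∂<•ν| ≤ B * ‖μ - ν‖ := by
  rw [← VectorMeasure.integral_sub_vectorMeasure (integrable_of_abs_le μ hf hB)
    (integrable_of_abs_le ν hf hB)]
  exact abs_integral_le (μ - ν) hB

theorem abs_integral_sub_integral_le_of_apply_univ_eq {μ ν : SignedMeasure X}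
    (hμν : μ univ = ν univ) {f : X → ℝ} (hf : Measurable f) {B B' : ℝ} (hB' : ∀ x, |f x| ≤ B')
    (hB : ∀ x y, |f x - f y| ≤ B) : |∫ᵛ x, f x ∂<•μ - ∫ᵛ x, f x ∂<•ν| ≤ B * ‖μ - ν‖ := by
  rw [← VectorMeasure.integral_sub_vectorMeasure (integrable_of_abs_le μ hf hB')
    (integrable_of_abs_le ν hf hB')]
  exact abs_integral_le_of_apply_univ_eq_zero (by rw [_root_.sub_apply, hμν, sub_self]) hf hB

end Integral

section Norms

theorem le_sInf_mul {s : Set ℝ≥0} (hs : s.Nonempty) {a d : ℝ≥0∞} (hd : d ≠ ∞)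
    (h : ∀ K ∈ s, a ≤ K * d) : a ≤ (sInf s : ℝ≥0) * d := by
  have := hs.to_subtype
  rw [ENNReal.coe_sInf hs, iInf_subtype', ENNReal.iInf_mul (by simp [hd])]
  exact le_iInf fun K => h K K.2

theorem IsLipschitzOn.lipschitzOnWith_lipConstOn {X Y : Type*} [PseudoMetricSpace X]
    [PseudoEMetricSpace Y] {f : X → Y} {s : Set X} (hf : IsLipschitzOn f s) :
    LipschitzOnWith (lipConstOn f s) f s := fun _ hx _ hy =>
  le_sInf_mul hf (edist_ne_top _ _) fun _ hK => hK hx hy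

theorem lipConstOn_le {X Y : Type*} [PseudoEMetricSpace X] [PseudoEMetricSpace Y] {f : X → Y}
    {s : Set X} {K : ℝ≥0} (hf : LipschitzOnWith K f s) : lipConstOn f s ≤ K :=
  csInf_le' hf

theorem IsBoundedOn.norm_le_supNormOn {X V : Type*} [Norm V] {f : X → V} {s : Set X}
    (hf : IsBoundedOn f s) {x : X} (hx : x ∈ s) : ‖f x‖ ≤ supNormOn f s := by
  obtain ⟨B, hB⟩ := hf
  exact le_ciSup (f := fun x : s => ‖f x‖) ⟨B, forall_mem_range.2 fun y => hB y y.2⟩ ⟨x, hx⟩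

theorem supNormOn_nonneg {X V : Type*} [SeminormedAddGroup V] (f : X → V) (s : Set X) :
    0 ≤ supNormOn f s :=
  Real.iSup_nonneg fun _ => norm_nonneg _

end Norms

section Wasserstein

theorem ofReal_integral_le_lintegral_ofReal {X : Type*} [MeasurableSpace X] {μ : Measure X}
    {f : X → ℝ} (hf : Integrable f μ) :
    ENNReal.ofReal (∫ x, f x ∂μ) ≤ ∫⁻ x, ENNReal.ofReal (f x) ∂μ := by
  rw [integral_eq_lintegral_pos_part_sub_lintegral_neg_part hf]
  exact (ENNReal.ofReal_le_ofReal (sub_le_self _ ENNReal.toReal_nonneg)).trans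
    ENNReal.ofReal_toReal_le

variable {X : Type*} [MetricSpace X] [MeasurableSpace X]

/-- A policy `π : S → P(X)` that is Lipschitz for the `1`-Wasserstein distance, which is the
weakest among the `W_p`. -/
def W1LipschitzWith {S : Type*} [PseudoEMetricSpace S] (Λ : ℝ≥0)
    (π : S → ProbabilityMeasure X) : Prop :=
  ∀ s s', wassersteinReal 1 (π s : Measure X) (π s') ≤ Λ * edist s s'

theorem policyLipschitzWith_policyLipConst {S E : Type*} [PseudoMetricSpace S] [PseudoMetricSpace E]
    {p : ℝ≥0∞} {C : Set E} {π : S × E → ProbabilityMeasure X}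
    (hπ : ∃ K : ℝ≥0, PolicyLipschitzWith p C K π) :
    PolicyLipschitzWith p C (policyLipConst p C π) π := fun s s' c hc c' hc' =>
  le_sInf_mul hπ (edist_ne_top _ _) fun _ hK => hK s s' c hc c' hc'

variable [BorelSpace X] {μ ν : Measure X}

theorem IsCoupling.isProbabilityMeasure [IsProbabilityMeasure μ]
    {Γ : @Measure (X × X) (borel (X × X))} (hΓ : IsCoupling μ ν Γ) :
    @IsProbabilityMeasure _ (borel (X × X)) Γ := by
  let : MeasurableSpace (X × X) := borel (X × X)
  have : BorelSpace (X × X) := ⟨rfl⟩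
  refine ⟨?_⟩
  rw [← preimage_univ (f := Prod.fst), ← Measure.map_apply continuous_fst.measurable .univ,
    hΓ.1, measure_univ]

theorem wassersteinReal_one_le_wassersteinReal {q : ℝ} (hq : 1 ≤ q) (μ ν : Measure X)
    [IsProbabilityMeasure μ] : wassersteinReal 1 μ ν ≤ wassersteinReal q μ ν := by
  let : MeasurableSpace (X × X) := borel (X × X)
  have : BorelSpace (X × X) := ⟨rfl⟩
  refine iInf₂_mono fun Γ hΓ => ?_
  have : IsProbabilityMeasure Γ := hΓ.isProbabilityMeasure
  have hdist : Measurable fun z : X × X => edist z.1 z.2 :=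
    (continuous_fst.edist continuous_snd).measurable
  simpa [eLpNorm'] using
    eLpNorm'_le_eLpNorm'_of_exponent_le one_pos hq Γ hdist.aestronglyMeasurable

theorem wassersteinReal_one_le_wasserstein {p : ℝ≥0∞} (hp : 1 ≤ p) (μ ν : Measure X)
    [IsProbabilityMeasure μ] : wassersteinReal 1 μ ν ≤ wasserstein p μ ν := by
  rw [wasserstein]
  split_ifs with h
  · exact le_iSup₂_of_le 1 le_rfl le_rfl
  · exact wassersteinReal_one_le_wassersteinReal (by simpa using ENNReal.toReal_mono h hp) μ ν

variable {f g : X → ℝ} {δ : ℝ} {L : ℝ≥0}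

theorem IsCoupling.ofReal_integral_sub_le_mul_lintegral [IsProbabilityMeasure μ]
    {Γ : @Measure (X × X) (borel (X × X))} (hΓ : IsCoupling μ ν Γ) (hf : Integrable f μ)
    (hg : Integrable g ν) (hfg : ∀ x y, f x - g y ≤ δ + L * dist x y) :
    ENNReal.ofReal (∫ x, f x ∂μ - ∫ y, g y ∂ν - δ) ≤
      L * @lintegral _ (borel (X × X)) Γ fun z => edist z.1 z.2 := by
  let : MeasurableSpace (X × X) := borel (X × X)
  have : BorelSpace (X × X) := ⟨rfl⟩
  have : IsProbabilityMeasure Γ := hΓ.isProbabilityMeasure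
  obtain ⟨rfl, rfl⟩ := hΓ
  have hfst : AEMeasurable (Prod.fst : X × X → X) Γ := continuous_fst.measurable.aemeasurable
  have hsnd : AEMeasurable (Prod.snd : X × X → X) Γ := continuous_snd.measurable.aemeasurable
  have hf' : Integrable (fun z : X × X => f z.1) Γ := hf.comp_aemeasurable hfst
  have hg' : Integrable (fun z : X × X => g z.2) Γ := hg.comp_aemeasurable hsnd
  have hmarginals : ∫ x, f x ∂Γ.map Prod.fst - ∫ y, g y ∂Γ.map Prod.snd - δ =
      ∫ z, (f z.1 - g z.2 - δ) ∂Γ := by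
    have hδ := integral_sub (hf'.sub hg') (integrable_const (μ := Γ) δ)
    simp only [Pi.sub_apply, integral_sub hf' hg', integral_const, probReal_univ, one_smul] at hδ
    rw [integral_map hfst hf.1, integral_map hsnd hg.1, hδ]
  calc _ = ENNReal.ofReal (∫ z, (f z.1 - g z.2 - δ) ∂Γ) := congrArg _ hmarginals
    _ ≤ ∫⁻ z, ENNReal.ofReal (f z.1 - g z.2 - δ) ∂Γ :=
        ofReal_integral_le_lintegral_ofReal ((hf'.sub hg').sub (integrable_const δ))
    _ ≤ ∫⁻ z, L * edist z.1 z.2 ∂Γ := by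
        refine lintegral_mono fun z => ?_
        rw [edist_dist, ← ENNReal.ofReal_coe_nnreal, ← ENNReal.ofReal_mul L.coe_nonneg]
        exact ENNReal.ofReal_le_ofReal (by linarith [hfg z.1 z.2])
    _ = L * ∫⁻ z, edist z.1 z.2 ∂Γ := lintegral_const_mul' _ _ ENNReal.coe_ne_top

theorem ofReal_integral_sub_le_mul_wassersteinReal [IsProbabilityMeasure μ]
    (hW : wassersteinReal 1 μ ν ≠ ∞) (hf : Integrable f μ) (hg : Integrable g ν)
    (hfg : ∀ x y, f x - g y ≤ δ + L * dist x y) :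
    ENNReal.ofReal (∫ x, f x ∂μ - ∫ y, g y ∂ν - δ) ≤ L * wassersteinReal 1 μ ν := by
  rw [wassersteinReal, iInf_subtype'] at hW ⊢
  have : Nonempty {Γ // IsCoupling μ ν Γ} := by
    by_contra h
    exact hW (@iInf_of_empty _ _ _ (not_nonempty_iff.1 h) _)
  rw [ENNReal.mul_iInf (by simp)]
  refine le_iInf fun Γ => ?_
  simpa using Γ.2.ofReal_integral_sub_le_mul_lintegral hf hg hfg

theorem PolicyLipschitzWith.w1LipschitzWith {S E : Type*} [PseudoEMetricSpace S]
    [PseudoEMetricSpace E] {p : ℝ≥0∞} (hp : 1 ≤ p) {C : Set E} {K : ℝ≥0}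
    {π : S × E → ProbabilityMeasure X} (hπ : PolicyLipschitzWith p C K π) {c : E} (hc : c ∈ C) :
    W1LipschitzWith K fun s => π (s, c) := fun s s' =>
  (wassersteinReal_one_le_wasserstein hp _ _).trans
    ((hπ s s' c hc c hc).trans_eq (by simp [Prod.edist_eq]))

end Wasserstein

section StateValue

variable {S A : Type*} [MetricSpace S] [MetricSpace A] [MeasurableSpace A]

/-- The state value function `s ↦ ∫ Q(s, a) dπ_s(a)` of the action value function `Q` under the
policy `π`. -/
noncomputable def stateValue (π : S → ProbabilityMeasure A) (Q : S × A → ℝ) (s : S) : ℝ :=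
  ∫ a, Q (s, a) ∂(π s : Measure A)

variable {π : S → ProbabilityMeasure A}

theorem abs_stateValue_le (π : S → ProbabilityMeasure A) (Q : S × A →ᵇ ℝ) (s : S) :
    |stateValue π Q s| ≤ ‖Q‖ := by
  simpa [stateValue] using norm_integral_le_of_norm_le_const (μ := (π s : Measure A))
    (f := fun a => Q (s, a)) (.of_forall fun a => Q.norm_coe_le_norm (s, a))

variable [BorelSpace A]

theorem integrable_boundedContinuous_section (Q : S × A →ᵇ ℝ) (s : S) (μ : Measure A)
    [IsFiniteMeasure μ] : Integrable (fun a => Q (s, a)) μ :=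
  (Q.compContinuous ⟨fun a => (s, a), by fun_prop⟩).integrable μ

theorem stateValue_sub (π : S → ProbabilityMeasure A) (Q Q' : S × A →ᵇ ℝ) (s : S) :
    stateValue π (Q - Q') s = stateValue π Q s - stateValue π Q' s :=
  integral_sub (integrable_boundedContinuous_section Q s _)
    (integrable_boundedContinuous_section Q' s _)

variable {Λ L : ℝ≥0} {Q : S × A →ᵇ ℝ}

theorem stateValue_sub_stateValue_le (hπ : W1LipschitzWith Λ π) (hQ : LipschitzWith L Q)
    (s s' : S) : stateValue π Q s - stateValue π Q s' ≤ L * (1 + Λ) * dist s s' := by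
  have hW : wassersteinReal 1 (π s : Measure A) (π s') ≠ ∞ :=
    ne_top_of_le_ne_top (ENNReal.mul_ne_top ENNReal.coe_ne_top (edist_ne_top s s')) (hπ s s')
  have hQs : ∀ a a', Q (s, a) - Q (s', a') ≤ L * dist s s' + L * dist a a' := fun a a' =>
    calc Q (s, a) - Q (s', a') ≤ L * dist (s, a) (s', a') :=
          (le_abs_self _).trans (hQ.dist_le_mul _ _)
      _ ≤ L * (dist s s' + dist a a') := by
          gcongr
          exact max_le_add_of_nonneg dist_nonneg dist_nonneg
      _ = _ := mul_add _ _ _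
  have hofReal : ENNReal.ofReal (stateValue π Q s - stateValue π Q s' - L * dist s s') ≤
      ENNReal.ofReal (L * (Λ * dist s s')) := by
    refine (ofReal_integral_sub_le_mul_wassersteinReal hW
      (integrable_boundedContinuous_section Q s _)
      (integrable_boundedContinuous_section Q s' _) hQs).trans ?_
    rw [ENNReal.ofReal_mul L.coe_nonneg, ENNReal.ofReal_mul Λ.coe_nonneg, ← edist_dist,
      ENNReal.ofReal_coe_nnreal, ENNReal.ofReal_coe_nnreal]
    gcongr
    exact hπ s s'
  have := (ENNReal.ofReal_le_ofReal_iff (by positivity)).1 hofReal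
  linarith

theorem lipschitzWith_stateValue (hπ : W1LipschitzWith Λ π) (hQ : LipschitzWith L Q) :
    LipschitzWith (L * (1 + Λ)) (stateValue π Q) :=
  LipschitzWith.of_dist_le_mul fun s s' =>
    abs_sub_le_iff.2 ⟨stateValue_sub_stateValue_le hπ hQ s s',
      dist_comm s s' ▸ stateValue_sub_stateValue_le hπ hQ s' s⟩

theorem measurable_stateValue [MeasurableSpace S] [BorelSpace S] (hπ : W1LipschitzWith Λ π)
    (hQ : LipschitzWith L Q) : Measurable (stateValue π Q) :=
  (lipschitzWith_stateValue hπ hQ).continuous.measurable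

end StateValue

section Bellman

variable {S A : Type*} [MetricSpace S] [MeasurableSpace S]
  [MetricSpace A] [MeasurableSpace A]
  {K K' : S × A → SignedMeasure S} {π : S → ProbabilityMeasure A} {Q Q' : S × A →ᵇ ℝ}

theorem abs_bellmanOp_le {z : S × A} (hK : IsProbability (K z)) :
    |bellmanOp K π Q z| ≤ ‖Q‖ :=
  (abs_integral_le (K z) (abs_stateValue_le π Q)).trans_eq (by rw [hK.norm_eq_one, mul_one])

theorem lipschitzWith_bellmanOp {LK : ℝ≥0} (hK : LipschitzWith LK K)
    (hQ : Measurable (stateValue π Q)) : LipschitzWith (‖Q‖₊ * LK) (bellmanOp K π Q) :=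
  LipschitzWith.of_dist_le_mul fun z z' =>
    calc dist (bellmanOp K π Q z) (bellmanOp K π Q z') ≤ ‖Q‖ * ‖K z - K z'‖ :=
          abs_integral_sub_integral_le _ _ hQ (abs_stateValue_le π Q)
      _ ≤ ‖Q‖ * (LK * dist z z') := by
          gcongr
          exact (dist_eq_norm _ _).symm.trans_le (hK.dist_le_mul z z')
      _ = _ := by rw [NNReal.coe_mul, coe_nnnorm, mul_assoc]

variable [BorelSpace A]

theorem abs_bellmanOp_sub_le {z : S × A} (hK : IsProbability (K z))
    (hQ : Measurable (stateValue π Q)) (hQ' : Measurable (stateValue π Q')) :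
    |bellmanOp K π Q z - bellmanOp K π Q' z| ≤ ‖Q - Q'‖ := by
  have hsub : bellmanOp K π Q z - bellmanOp K π Q' z = bellmanOp K π (Q - Q') z :=
    calc _ = ∫ᵛ s, (stateValue π Q s - stateValue π Q' s) ∂<•(K z) :=
          (VectorMeasure.integral_fun_sub (integrable_of_abs_le _ hQ (abs_stateValue_le π Q))
            (integrable_of_abs_le _ hQ' (abs_stateValue_le π Q'))).symm
      _ = _ := by simp only [← stateValue_sub]; rfl
  rw [hsub]
  exact abs_bellmanOp_le (Q := Q - Q') hK

variable {Λ D L : ℝ≥0} [BorelSpace S]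

theorem abs_bellmanOp_sub_bellmanOp_le (hD : ∀ s s' : S, dist s s' ≤ D) {z z' : S × A}
    (hK : K z univ = K' z' univ) (hπ : W1LipschitzWith Λ π) (hQ : LipschitzWith L Q) :
    |bellmanOp K π Q z - bellmanOp K' π Q z'| ≤ L * (1 + Λ) * D * ‖K z - K' z'‖ := by
  refine abs_integral_sub_integral_le_of_apply_univ_eq hK (measurable_stateValue hπ hQ)
    (abs_stateValue_le π Q) fun s s' => ?_
  refine ((lipschitzWith_stateValue hπ hQ).dist_le_mul s s').trans ?_
  push_cast
  gcongr
  exact hD s s'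

theorem lipschitzWith_bellmanOp_of_dist_le (hD : ∀ s s' : S, dist s s' ≤ D) {LK : ℝ≥0}
    (hK : ∀ z, K z univ = 1) (hKL : LipschitzWith LK K) (hπ : W1LipschitzWith Λ π)
    (hQ : LipschitzWith L Q) : LipschitzWith (L * (1 + Λ) * D * LK) (bellmanOp K π Q) :=
  LipschitzWith.of_dist_le_mul fun z z' =>
    calc dist (bellmanOp K π Q z) (bellmanOp K π Q z') ≤ L * (1 + Λ) * D * ‖K z - K z'‖ :=
          abs_bellmanOp_sub_bellmanOp_le hD ((hK z).trans (hK z').symm) hπ hQ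
      _ ≤ L * (1 + Λ) * D * (LK * dist z z') := by
          gcongr
          exact (dist_eq_norm _ _).symm.trans_le (hKL.dist_le_mul z z')
      _ = _ := by push_cast; ring

end Bellman

section QFunction

theorem lipschitzWith_add_const_mul {X : Type*} [PseudoEMetricSpace X] {Lr Lf γ : ℝ≥0}
    {r f : X → ℝ} (hr : LipschitzWith Lr r) (hf : LipschitzWith Lf f) :
    LipschitzWith (Lr + γ * Lf) fun x => r x + γ * f x := by
  simpa using hr.add ((lipschitzWith_smul (γ : ℝ)).comp hf)

theorem isClosed_norm_le_lipschitzWith {X : Type*} [PseudoMetricSpace X] (B L : ℝ≥0) :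
    IsClosed {f : X →ᵇ ℝ | ‖f‖ ≤ B ∧ LipschitzWith L f} := by
  have hB : IsClosed {f : X →ᵇ ℝ | ‖f‖ ≤ B} := isClosed_le continuous_norm continuous_const
  have hcoe : Continuous fun f : X →ᵇ ℝ => (f : X → ℝ) := BoundedContinuousFunction.continuous_coe
  have hL : IsClosed {f : X →ᵇ ℝ | LipschitzWith L f} :=
    (isClosed_setOfPred_lipschitzWith L).preimage hcoe
  exact hB.inter hL

variable {S A : Type*} [MetricSpace S] [MeasurableSpace S]
  [MetricSpace A] [MeasurableSpace A]
  {γ Λ D : ℝ≥0} {r r' : S × A → ℝ} {K K' : S × A → SignedMeasure S}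
  {π : S → ProbabilityMeasure A}

theorem IsQFunction.lipschitzWith {Q : S × A → ℝ} (hQ : IsQFunction γ r K π Q) :
    LipschitzWith (lipConstOn Q univ) Q :=
  lipschitzOnWith_univ.1 hQ.lipschitz.lipschitzOnWith_lipConstOn

theorem IsQFunction.exists_boundedContinuousFunction {Q : S × A → ℝ}
    (hQ : IsQFunction γ r K π Q) : ∃ F : S × A →ᵇ ℝ, ⇑F = Q := by
  obtain ⟨B, hB⟩ := hQ.bounded
  exact ⟨.ofNormedAddCommGroup Q hQ.lipschitzWith.continuous B fun z => hB z (mem_univ z), rfl⟩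

theorem exists_bellman_update {B L Br Lr LK : ℝ≥0} (hr : ∀ z, ‖r z‖ ≤ Br) (hrL : LipschitzWith Lr r)
    (hK : ∀ z, IsProbability (K z)) (hKL : LipschitzWith LK K) {Q : S × A →ᵇ ℝ} (hQB : ‖Q‖ ≤ B)
    (hQ : Measurable (stateValue π Q)) (hB : Br + γ * B ≤ B) (hL : Lr + γ * (B * LK) ≤ L) :
    ∃ F : S × A →ᵇ ℝ, (‖F‖ ≤ B ∧ LipschitzWith L F) ∧
      ∀ z, F z = r z + γ * bellmanOp K π Q z := by
  have hlip : LipschitzWith L fun z => r z + γ * bellmanOp K π Q z := by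
    have := lipschitzWith_add_const_mul (γ := γ) hrL (lipschitzWith_bellmanOp hKL hQ)
    refine this.weaken (le_trans ?_ hL)
    gcongr
    exact hQB
  have hbound : ∀ z, ‖r z + γ * bellmanOp K π Q z‖ ≤ B := fun z =>
    calc ‖r z + γ * bellmanOp K π Q z‖ ≤ ‖r z‖ + γ * |bellmanOp K π Q z| :=
          (norm_add_le _ _).trans_eq (by rw [norm_mul, NNReal.norm_eq]; rfl)
      _ ≤ Br + γ * B := by
          gcongr
          · exact hr z
          · exact (abs_bellmanOp_le (hK z)).trans hQB
      _ ≤ B := mod_cast hB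
  exact ⟨.ofNormedAddCommGroup _ hlip.continuous B hbound,
    ⟨BoundedContinuousFunction.norm_ofNormedAddCommGroup_le _ B.coe_nonneg hbound, hlip⟩,
    fun _ => rfl⟩

variable [BorelSpace S] [BorelSpace A]

theorem exists_bellman_fixedPoint {B L Br Lr LK : ℝ≥0} (hγ : γ < 1) (hr : ∀ z, ‖r z‖ ≤ Br)
    (hrL : LipschitzWith Lr r) (hK : ∀ z, IsProbability (K z)) (hKL : LipschitzWith LK K)
    (hπ : W1LipschitzWith Λ π) (hB : Br + γ * B ≤ B) (hL : Lr + γ * (B * LK) ≤ L) :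
    ∃ F : S × A →ᵇ ℝ, LipschitzWith L F ∧ ∀ z, F z = r z + γ * bellmanOp K π F z := by
  let P := {Q : S × A →ᵇ ℝ | ‖Q‖ ≤ B ∧ LipschitzWith L Q}
  have hm : ∀ Q : P, Measurable (stateValue π Q) := fun Q => measurable_stateValue hπ Q.2.2
  choose Φ hΦP hΦ using fun Q : P => exists_bellman_update hr hrL hK hKL Q.2.1 (hm Q) hB hL
  have hcontr : ContractingWith γ fun Q => (⟨Φ Q, hΦP Q⟩ : P) := by
    refine ⟨hγ, LipschitzWith.of_dist_le_mul fun Q Q' => ?_⟩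
    refine (BoundedContinuousFunction.dist_le (by positivity)).2 fun z => ?_
    simp only [hΦ]
    rw [Real.dist_eq, add_sub_add_left_eq_sub, ← mul_sub, abs_mul, NNReal.abs_eq]
    gcongr
    exact (abs_bellmanOp_sub_le (hK z) (hm Q) (hm Q')).trans_eq (dist_eq_norm _ _).symm
  have : CompleteSpace P := (isClosed_norm_le_lipschitzWith B L).completeSpace_coe
  have : Nonempty P := ⟨⟨0, by simp, LipschitzWith.const' 0⟩⟩
  have hfix := congrArg Subtype.val hcontr.fixedPoint_isFixedPt
  exact ⟨_, (hcontr.fixedPoint _).2.2, fun z => (DFunLike.congr_fun hfix z).symm.trans (hΦ _ z)⟩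

theorem exists_isQFunction {Lr LK : ℝ≥0} (hγ : γ < 1) (hr : IsBoundedOn r univ)
    (hrL : LipschitzWith Lr r) (hK : ∀ z, IsProbability (K z)) (hKL : LipschitzWith LK K)
    (hπ : W1LipschitzWith Λ π) : ∃ Q, IsQFunction γ r K π Q := by
  obtain ⟨Br, hBr⟩ := hr
  have hB : Br.toNNReal + γ * (Br.toNNReal / (1 - γ)) ≤ Br.toNNReal / (1 - γ) :=
    calc _ = Br.toNNReal / (1 - γ) * ((1 - γ) + γ) := by
          rw [mul_add, div_mul_cancel₀ _ (tsub_pos_of_lt hγ).ne', mul_comm γ]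
      _ ≤ _ := by rw [tsub_add_cancel_of_le hγ.le, mul_one]
  obtain ⟨F, hFL, hF⟩ := exists_bellman_fixedPoint hγ
    (fun z => (hBr z (mem_univ z)).trans (Real.le_coe_toNNReal Br)) hrL hK hKL hπ hB le_rfl
  exact ⟨F, ⟨‖F‖, fun z _ => F.norm_coe_le_norm z⟩, ⟨_, hFL.lipschitzOnWith⟩, hF⟩

theorem IsQFunction.abs_sub_le {Q Q' : S × A → ℝ} (hγ : γ < 1) (hQ : IsQFunction γ r K π Q)
    (hQ' : IsQFunction γ r' K' π Q') (hK : ∀ z, IsProbability (K z)) (hπ : W1LipschitzWith Λ π)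
    {δ η : ℝ} (hr : ∀ z, |r z - r' z| ≤ δ)
    (hKK' : ∀ z, |bellmanOp K π Q' z - bellmanOp K' π Q' z| ≤ η) (z : S × A) :
    |Q z - Q' z| ≤ (δ + γ * η) / (1 - γ) := by
  obtain ⟨F, rfl⟩ := hQ.exists_boundedContinuousFunction
  obtain ⟨F', rfl⟩ := hQ'.exists_boundedContinuousFunction
  have hm := measurable_stateValue hπ hQ.lipschitzWith
  have hm' := measurable_stateValue hπ hQ'.lipschitzWith
  have : Nonempty (S × A) := ⟨z⟩
  have hstep : ‖F - F'‖ ≤ δ + γ * (‖F - F'‖ + η) := by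
    refine BoundedContinuousFunction.norm_le_of_nonempty.2 fun z => ?_
    calc |F z - F' z| = |(r z - r' z) + γ * ((bellmanOp K π F z - bellmanOp K π F' z) +
            (bellmanOp K π F' z - bellmanOp K' π F' z))| := by
          rw [hQ.bellman, hQ'.bellman]
          ring_nf
      _ ≤ |r z - r' z| + γ * (|bellmanOp K π F z - bellmanOp K π F' z| +
            |bellmanOp K π F' z - bellmanOp K' π F' z|) := by
          refine (abs_add_le _ _).trans ?_
          rw [abs_mul, NNReal.abs_eq]
          gcongr
          exact abs_add_le _ _
      _ ≤ δ + γ * (‖F - F'‖ + η) := by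
          gcongr
          · exact hr z
          · exact abs_bellmanOp_sub_le (hK z) hm hm'
          · exact hKK' z
  refine ((F - F').norm_coe_le_norm z).trans ?_
  rw [le_div_iff₀ (sub_pos.2 (mod_cast hγ))]
  linarith

theorem existsUnique_isQFunction {Lr LK : ℝ≥0} (hγ : γ < 1) (hr : IsBoundedOn r univ)
    (hrL : LipschitzWith Lr r) (hK : ∀ z, IsProbability (K z)) (hKL : LipschitzWith LK K)
    (hπ : W1LipschitzWith Λ π) : ∃! Q, IsQFunction γ r K π Q := by
  refine existsUnique_of_exists_of_unique (exists_isQFunction hγ hr hrL hK hKL hπ)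
    fun Q Q' hQ hQ' => funext fun z => ?_
  simpa [sub_eq_zero] using hQ.abs_sub_le hγ hQ' hK hπ (δ := 0) (η := 0) (by simp) (by simp) z

theorem IsQFunction.lipConstOn_le {Q : S × A → ℝ} {Lr LK : ℝ≥0} (hQ : IsQFunction γ r K π Q)
    (hD : ∀ s s' : S, dist s s' ≤ D) (hrL : LipschitzWith Lr r) (hK : ∀ z, K z univ = 1)
    (hKL : LipschitzWith LK K) (hπ : W1LipschitzWith Λ π) (hκ : γ * (D * LK * (1 + Λ)) < 1) :
    (lipConstOn Q univ : ℝ) ≤ Lr / (1 - γ * (D * LK * (1 + Λ))) := by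
  have hstep : lipConstOn Q univ ≤ Lr + γ * (lipConstOn Q univ * (1 + Λ) * D * LK) := by
    obtain ⟨F, rfl⟩ := hQ.exists_boundedContinuousFunction
    have hlip := lipschitzWith_add_const_mul (γ := γ) hrL
      (lipschitzWith_bellmanOp_of_dist_le hD hK hKL hπ hQ.lipschitzWith)
    rw [← funext hQ.bellman] at hlip
    exact CEBE.lipConstOn_le (lipschitzOnWith_univ.2 hlip)
  rw [← NNReal.coe_le_coe] at hstep
  push_cast at hstep
  rw [le_div_iff₀ (sub_pos.2 (mod_cast hκ))]
  linarith

end QFunction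

section Linearization

theorem norm_sub_sub_fderiv_le {E F : Type*} [NormedAddCommGroup E] [NormedSpace ℝ E]
    [NormedAddCommGroup F] [NormedSpace ℝ F] {f : E → F} {M : ℝ} {x y : E}
    (hf : ∀ u ∈ segment ℝ x y, ContDiffAt ℝ 2 f u)
    (hM : ∀ u ∈ segment ℝ x y, ‖fderiv ℝ (fderiv ℝ f) u‖ ≤ M) :
    ‖f y - f x - fderiv ℝ f x (y - x)‖ ≤ M * ‖y - x‖ ^ 2 := by
  have hx := left_mem_segment ℝ x y
  have hM₀ : 0 ≤ M := (norm_nonneg (fderiv ℝ (fderiv ℝ f) x)).trans (hM x hx)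
  have hfderiv : ∀ u ∈ segment ℝ x y, ‖fderiv ℝ f u - fderiv ℝ f x‖ ≤ M * ‖y - x‖ := fun u hu =>
    calc ‖fderiv ℝ f u - fderiv ℝ f x‖ ≤ M * ‖u - x‖ :=
          (convex_segment x y).norm_image_sub_le_of_norm_fderiv_le
            (fun v hv => ((hf v hv).fderiv_right (m := 1) le_rfl).differentiableAt one_ne_zero)
            hM hx hu
      _ ≤ M * ‖y - x‖ := by
          gcongr
          exact norm_sub_le_of_mem_segment hu
  calc ‖f y - f x - fderiv ℝ f x (y - x)‖ ≤ M * ‖y - x‖ * ‖y - x‖ :=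
        (convex_segment x y).norm_image_sub_le_of_norm_fderiv_le'
          (fun u hu => (hf u hu).differentiableAt two_ne_zero) hfderiv hx (right_mem_segment ℝ x y)
    _ = M * ‖y - x‖ ^ 2 := by ring

/-- Evaluation of a signed measure at the set `i`, as a continuous linear form for the total
variation norm; it transports the conservation of mass through derivatives. -/
noncomputable def evalCLM {X : Type*} [MeasurableSpace X] (i : Set X) : SignedMeasure X →L[ℝ] ℝ :=
  LinearMap.mkContinuous ⟨⟨fun μ => μ i, fun _ _ => rfl⟩, fun _ _ => rfl⟩ 1 fun μ =>
    (abs_apply_le_norm μ i).trans_eq (one_mul _).symm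

theorem isBoundedOn_slice {S A E F : Type*} [Norm F] {C : Set E} {f : S × A × E → F} {c : E}
    (hf : IsBoundedOn f (dom S A C)) (hc : c ∈ C) : IsBoundedOn (slice f c) univ :=
  hf.imp fun _ hB z _ => hB (z.1, z.2, c) hc

theorem lipschitzWith_slice {S A E F : Type*} [PseudoMetricSpace S] [PseudoMetricSpace A]
    [PseudoMetricSpace E] [PseudoEMetricSpace F] {C : Set E} {f : S × A × E → F} {c : E}
    (hf : IsLipschitzOn f (dom S A C)) (hc : c ∈ C) :
    LipschitzWith (lipConstOn f (dom S A C)) (slice f c) := fun z z' =>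
  (hf.lipschitzOnWith_lipConstOn (x := (z.1, z.2, c)) hc (y := (z'.1, z'.2, c)) hc).trans_eq
    (by simp [Prod.edist_eq])

variable {S A E F : Type*} [NormedAddCommGroup E] [NormedSpace ℝ E]
  [NormedAddCommGroup F] [NormedSpace ℝ F] {C : Set E} {f : S × A × E → F} {c₀ c : E}

theorem norm_linearize_sub_slice_le (hC : IsOpen C) (hf : IsC2InContext f C)
    (hf₂ : IsBoundedOn (partialC (partialC f)) (dom S A C)) (hseg : segment ℝ c₀ c ⊆ C)
    (z : S × A) :
    ‖linearize f c₀ c z - slice f c z‖ ≤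
      supNormOn (partialC (partialC f)) (dom S A C) * ‖c - c₀‖ ^ 2 := by
  rw [norm_sub_rev, linearize, ← sub_sub]
  exact norm_sub_sub_fderiv_le (f := fun x => f (z.1, z.2, x))
    (fun u hu => (hf z.1 z.2).contDiffAt (hC.mem_nhds (hseg hu)))
    fun u hu => hf₂.norm_le_supNormOn (x := (z.1, z.2, u)) (hseg hu)

theorem isBoundedOn_linearize (hC : IsOpen C) (hf : IsC2InContext f C)
    (hf₀ : IsBoundedOn f (dom S A C)) (hf₂ : IsBoundedOn (partialC (partialC f)) (dom S A C))
    (hseg : segment ℝ c₀ c ⊆ C) : IsBoundedOn (linearize f c₀ c) univ := by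
  obtain ⟨B, hB⟩ := isBoundedOn_slice hf₀ (hseg (right_mem_segment ℝ c₀ c))
  exact ⟨_, fun z hz => (norm_le_norm_sub_add _ (slice f c z)).trans
    (add_le_add (norm_linearize_sub_slice_le hC hf hf₂ hseg z) (hB z hz))⟩

theorem linearize_apply_univ [MeasurableSpace S] (hC : IsOpen C) {T : S × A × E → SignedMeasure S}
    {m : ℝ} (hT : ∀ z ∈ dom S A C, T z univ = m) (hT₂ : IsC2InContext T C) (hc₀ : c₀ ∈ C)
    (z : S × A) : linearize T c₀ c z univ = m := by
  have hdiff : DifferentiableAt ℝ (fun x => T (z.1, z.2, x)) c₀ :=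
    ((hT₂ z.1 z.2).contDiffAt (hC.mem_nhds hc₀)).differentiableAt two_ne_zero
  have hmass : (fun x => evalCLM univ (T (z.1, z.2, x))) =ᶠ[nhds c₀] fun _ => m := by
    filter_upwards [hC.mem_nhds hc₀] with x hx using hT (z.1, z.2, x) hx
  have hderiv : (evalCLM univ).comp (partialC T (z.1, z.2, c₀)) = 0 :=
    ((evalCLM univ).hasFDerivAt.comp c₀ hdiff.hasFDerivAt).unique
      ((hasFDerivAt_const m c₀).congr_of_eventuallyEq hmass)
  have hpartial : partialC T (z.1, z.2, c₀) (c - c₀) univ = 0 := DFunLike.congr_fun hderiv (c - c₀)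
  rw [linearize, _root_.add_apply, hpartial, hT (z.1, z.2, c₀) hc₀, add_zero]

theorem lipschitzWith_linearize [PseudoMetricSpace S] [PseudoMetricSpace A]
    (hf : IsLipschitzOn f (dom S A C)) (hf₁ : IsLipschitzOn (partialC f) (dom S A C))
    (hc₀ : c₀ ∈ C) :
    LipschitzWith (lipConstOn f (dom S A C) + ‖c - c₀‖₊ * lipConstOn (partialC f) (dom S A C))
      (linearize f c₀ c) :=
  (lipschitzWith_slice hf hc₀).add <|
    (ContinuousLinearMap.lipschitz_apply (c - c₀)).comp (lipschitzWith_slice hf₁ hc₀)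

end Linearization

section ErrorBound

theorem IsQFunction.supNormOn_sub_le {S A : Type*} [MetricSpace S] [MeasurableSpace S]
    [BorelSpace S] [MetricSpace A] [MeasurableSpace A] [BorelSpace A] {γ Λ D : ℝ≥0}
    {r r' : S × A → ℝ} {K K' : S × A → SignedMeasure S} {π : S → ProbabilityMeasure A}
    {Q Q' : S × A → ℝ} (hγ : γ < 1) (hQ : IsQFunction γ r K π Q) (hQ' : IsQFunction γ r' K' π Q')
    (hD : ∀ s s' : S, dist s s' ≤ D) (hK : ∀ z, IsProbability (K z))
    (hK' : ∀ z, IsProbability (K' z)) (hπ : W1LipschitzWith Λ π) {L δ ε : ℝ} (hδ : 0 ≤ δ)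
    (hε : 0 ≤ ε) (hL : lipConstOn Q' univ ≤ L) (hr : ∀ z, ‖r z - r' z‖ ≤ δ)
    (hKK' : ∀ z, ‖K z - K' z‖ ≤ ε) :
    supNormOn (Q - Q') univ ≤ (δ + γ * (L * (1 + Λ) * D * ε)) / (1 - γ) := by
  have hL₀ : 0 ≤ L := (lipConstOn Q' univ).coe_nonneg.trans hL
  have hγ' : 0 ≤ 1 - (γ : ℝ) := sub_nonneg.2 (mod_cast hγ.le)
  have hbellman : ∀ z, |bellmanOp K π Q' z - bellmanOp K' π Q' z| ≤ L * (1 + Λ) * D * ε := by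
    have hLip := hQ'.lipschitzWith
    obtain ⟨F, rfl⟩ := hQ'.exists_boundedContinuousFunction
    intro z
    refine (abs_bellmanOp_sub_bellmanOp_le hD ((hK z).2.trans (hK' z).2.symm) hπ hLip).trans ?_
    gcongr
    exact hKK' z
  exact Real.iSup_le (fun z => hQ.abs_sub_le hγ hQ' hK hπ hr hbellman z) (by positivity)

theorem div_one_sub_mul_le_div_one_sub_mul_max {γ κ a b : ℝ} (hγ₀ : 0 ≤ γ) (hγ₁ : γ < 1)
    (hκ : γ * κ < 1) (hb : 0 ≤ b) (hab : a ≤ b) :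
    a / (1 - γ * κ) ≤ b / (1 - γ * max 1 κ) := by
  have hmax : γ * max 1 κ < 1 := by
    rw [mul_max_of_nonneg _ _ hγ₀, mul_one]
    exact max_lt hγ₁ hκ
  refine div_le_div₀ hb hab (sub_pos.2 hmax) ?_
  gcongr
  exact le_max_right 1 κ

theorem mul_lt_one_of_ofReal_lt_one_div {x y z : ℝ} (hx : 0 ≤ x) (hzy : z ≤ y)
    (h : ENNReal.ofReal x < 1 / ENNReal.ofReal y) : x * z < 1 := by
  refine (mul_le_mul_of_nonneg_left hzy hx).trans_lt ?_
  rcases le_or_gt y 0 with hy | hy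
  · exact (mul_nonpos_of_nonneg_of_nonpos hx hy).trans_lt one_pos
  · rw [ENNReal.lt_div_iff_mul_lt (.inl (ENNReal.ofReal_pos.2 hy).ne') (.inl ENNReal.ofReal_ne_top),
      ← ENNReal.ofReal_mul hx] at h
    exact ENNReal.ofReal_lt_one.1 h

theorem supNormOn_sub_le_of_linearize {S A E : Type*} [MetricSpace S] [BoundedSpace S]
    [MeasurableSpace S] [BorelSpace S] [MetricSpace A] [MeasurableSpace A] [BorelSpace A]
    [NormedAddCommGroup E] [NormedSpace ℝ E] {C : Set E} (hC : IsOpen C)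
    {T : S × A × E → SignedMeasure S} (hTprob : ∀ z ∈ dom S A C, IsProbability (T z))
    (hTC2 : IsC2InContext T C) (hTbdd₂ : IsBoundedOn (partialC (partialC T)) (dom S A C))
    (hTlip : IsLipschitzOn T (dom S A C)) {R : S × A × E → ℝ} (hRC2 : IsC2InContext R C)
    (hRbdd₂ : IsBoundedOn (partialC (partialC R)) (dom S A C))
    (hRlip : IsLipschitzOn R (dom S A C)) {Λ γ : ℝ≥0} {π : S → ProbabilityMeasure A}
    (hπ : W1LipschitzWith Λ π) {c₀ c : E} (hseg : segment ℝ c₀ c ⊆ C) (hγ : γ < 1)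
    (hκ : γ * (Metric.diam (univ : Set S) * lipConstOn T (dom S A C) * (1 + Λ)) < 1)
    {Qbe Qce : S × A → ℝ} (hbe : IsQFunction γ (slice R c) (slice T c) π Qbe)
    (hce : IsQFunction γ (linearize R c₀ c) (fun z => simplexProj (linearize T c₀ c z)) π Qce) :
    supNormOn (Qce - Qbe) univ ≤ ‖c - c₀‖ ^ 2 / (1 - γ) *
      (supNormOn (partialC (partialC R)) (dom S A C) +
        3 * γ * Metric.diam (univ : Set S) * (1 + Λ) * lipNormOn R (dom S A C) *
          supNormOn (partialC (partialC T)) (dom S A C) /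
        (1 - γ * max 1 (Metric.diam (univ : Set S) * lipConstOn T (dom S A C) * (1 + Λ)))) := by
  let D : ℝ≥0 := ⟨Metric.diam (univ : Set S), Metric.diam_nonneg⟩
  have hD : ∀ s s' : S, dist s s' ≤ D := fun s s' =>
    Metric.dist_le_diam_of_mem (.all univ) (mem_univ s) (mem_univ s')
  have hc : c ∈ C := hseg (right_mem_segment ℝ c₀ c)
  have hTbe : ∀ z, IsProbability (slice T c z) := fun z => hTprob (z.1, z.2, c) hc
  have hmass := linearize_apply_univ (c := c) hC (fun z hz => (hTprob z hz).2) hTC2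
    (hseg (left_mem_segment ℝ c₀ c))
  have hT : ∀ z, ‖simplexProj (linearize T c₀ c z) - slice T c z‖ ≤
      3 * (supNormOn (partialC (partialC T)) (dom S A C) * ‖c - c₀‖ ^ 2) := fun z =>
    (norm_simplexProj_sub_le (hmass z) (hTbe z).1).trans
      (mul_le_mul_of_nonneg_left (norm_linearize_sub_slice_le hC hTC2 hTbdd₂ hseg z) zero_le_three)
  have hQbe : lipConstOn Qbe univ ≤ lipNormOn R (dom S A C) /
      (1 - γ * max 1 (D * lipConstOn T (dom S A C) * (1 + Λ))) :=
    (hbe.lipConstOn_le hD (lipschitzWith_slice hRlip hc) (fun z => (hTbe z).2)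
      (lipschitzWith_slice hTlip hc) hπ hκ).trans <|
      div_one_sub_mul_le_div_one_sub_mul_max γ.2 hγ hκ
        (le_max_of_le_right (NNReal.coe_nonneg _)) (le_max_right _ _)
  have hMR := supNormOn_nonneg (partialC (partialC R)) (dom S A C)
  have hMT := supNormOn_nonneg (partialC (partialC T)) (dom S A C)
  refine (hce.supNormOn_sub_le hγ hbe hD (fun z => isProbability_simplexProj (hmass z)) hTbe hπ
    (by positivity) (by positivity) hQbe (norm_linearize_sub_slice_le hC hRC2 hRbdd₂ hseg)
    hT).trans_eq ?_
  change _ = ‖c - c₀‖ ^ 2 / (1 - γ) * (_ + 3 * γ * D * (1 + Λ) * _ * _ /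
    (1 - γ * max 1 (D * lipConstOn T (dom S A C) * (1 + Λ))))
  ring

end ErrorBound

end CEBE

theorem theorem3_general
    {S A E : Type*}
    [MetricSpace S] [BoundedSpace S] [MeasurableSpace S] [BorelSpace S]
    [MetricSpace A] [MeasurableSpace A] [BorelSpace A]
    [NormedAddCommGroup E] [NormedSpace ℝ E]
    {C : Set E} (hC : IsOpen C) {p : ℝ≥0∞} (hp : 1 ≤ p)
    {T : S × A × E → SignedMeasure S}
    (hTprob : ∀ z ∈ CEBE.dom S A C, CEBE.IsProbability (T z))
    (hTC2 : CEBE.IsC2InContext T C)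
    (hTbdd₂ : CEBE.IsBoundedOn (CEBE.partialC (CEBE.partialC T)) (CEBE.dom S A C))
    (hTlip : CEBE.IsLipschitzOn T (CEBE.dom S A C))
    (hTlip₁ : CEBE.IsLipschitzOn (CEBE.partialC T) (CEBE.dom S A C))
    {R : S × A × E → ℝ}
    (hRC2 : CEBE.IsC2InContext R C)
    (hRbdd : CEBE.IsBoundedOn R (CEBE.dom S A C))
    (hRbdd₂ : CEBE.IsBoundedOn (CEBE.partialC (CEBE.partialC R)) (CEBE.dom S A C))
    (hRlip : CEBE.IsLipschitzOn R (CEBE.dom S A C))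
    (hRlip₁ : CEBE.IsLipschitzOn (CEBE.partialC R) (CEBE.dom S A C))
    {π : S × E → ProbabilityMeasure A} (hπ : ∃ K : ℝ≥0, CEBE.PolicyLipschitzWith p C K π)
    {c₀ c : E} (hseg : segment ℝ c₀ c ⊆ C) {γ : ℝ} (hγ₀ : 0 ≤ γ) (hγ₁ : γ < 1) :
    (∀ z, 0 < (CEBE.linearize T c₀ c z).toJordanDecomposition.posPart univ) ∧
    (∃! Q : S × A → ℝ,
      CEBE.IsQFunction γ (CEBE.slice R c) (CEBE.slice T c) (fun s => π (s, c)) Q) ∧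
    (∃! Q : S × A → ℝ,
      CEBE.IsQFunction γ (CEBE.linearize R c₀ c)
        (fun z => CEBE.simplexProj (CEBE.linearize T c₀ c z)) (fun s => π (s, c)) Q) ∧
    (γ * (Metric.diam (univ : Set S) * CEBE.lipConstOn T (CEBE.dom S A C) *
        (1 + CEBE.policyLipConst p C π)) < 1 →
      ∀ Qbe Qce : S × A → ℝ,
        CEBE.IsQFunction γ (CEBE.slice R c) (CEBE.slice T c) (fun s => π (s, c)) Qbe →
        CEBE.IsQFunction γ (CEBE.linearize R c₀ c)
          (fun z => CEBE.simplexProj (CEBE.linearize T c₀ c z)) (fun s => π (s, c)) Qce →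
        CEBE.supNormOn (Qce - Qbe) univ ≤
          ‖c - c₀‖ ^ 2 / (1 - γ) *
            (CEBE.supNormOn (CEBE.partialC (CEBE.partialC R)) (CEBE.dom S A C) +
              3 * γ * Metric.diam (univ : Set S) * (1 + CEBE.policyLipConst p C π) *
                CEBE.lipNormOn R (CEBE.dom S A C) *
                CEBE.supNormOn (CEBE.partialC (CEBE.partialC T)) (CEBE.dom S A C) /
              (1 - γ * max 1 (Metric.diam (univ : Set S) *
                CEBE.lipConstOn T (CEBE.dom S A C) * (1 + CEBE.policyLipConst p C π))))) := by
  lift γ to ℝ≥0 using hγ₀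
  have hc₀ : c₀ ∈ C := hseg (left_mem_segment ℝ c₀ c)
  have hc : c ∈ C := hseg (right_mem_segment ℝ c₀ c)
  have hW := (CEBE.policyLipschitzWith_policyLipConst hπ).w1LipschitzWith hp hc
  have hmass := CEBE.linearize_apply_univ (c := c) hC (fun z hz => (hTprob z hz).2) hTC2 hc₀
  have hTbe : ∀ z, CEBE.IsProbability (CEBE.slice T c z) := fun z => hTprob (z.1, z.2, c) hc
  have hTce := fun z => CEBE.isProbability_simplexProj (hmass z)
  have hTbeLip := CEBE.lipschitzWith_slice hTlip hc
  have hTceLip := CEBE.lipschitzWith_simplexProj_comp hmass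
    (CEBE.lipschitzWith_linearize hTlip hTlip₁ hc₀)
  have hRbeLip := CEBE.lipschitzWith_slice hRlip hc
  have hRceLip := CEBE.lipschitzWith_linearize (c := c) hRlip hRlip₁ hc₀
  have hRbe := CEBE.isBoundedOn_slice hRbdd hc
  have hRce := CEBE.isBoundedOn_linearize hC hRC2 hRbdd hRbdd₂ hseg
  exact ⟨fun z => CEBE.posPart_univ_pos (hmass z),
    CEBE.existsUnique_isQFunction hγ₁ hRbe hRbeLip hTbe hTbeLip hW,
    CEBE.existsUnique_isQFunction hγ₁ hRce hRceLip hTce hTceLip hW,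
    fun hκ _ _ hbe hce => CEBE.supNormOn_sub_le_of_linearize hC hTprob hTC2 hTbdd₂ hTlip hRC2
      hRbdd₂ hRlip hW hseg hγ₁ hκ hbe hce⟩

theorem theorem3
    {S A E : Type*}
    [MetricSpace S] [BoundedSpace S] [MeasurableSpace S] [BorelSpace S]
    [MetricSpace A] [MeasurableSpace A] [BorelSpace A]
    [NormedAddCommGroup E] [NormedSpace ℝ E] [CompleteSpace E]
    (C : Set E) (hCopen : IsOpen C) (hCconv : Convex ℝ C)
    (p : ℝ≥0∞) (hp : 1 ≤ p)
    -- transitions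
    (T : S × A × E → SignedMeasure S)
    (hTprob : ∀ z ∈ CEBE.dom S A C, CEBE.IsProbability (T z))
    (hTC2 : CEBE.IsC2InContext T C)
    (hTbdd₁ : CEBE.IsBoundedOn (CEBE.partialC T) (CEBE.dom S A C))
    (hTbdd₂ : CEBE.IsBoundedOn (CEBE.partialC (CEBE.partialC T)) (CEBE.dom S A C))
    (hTlip : CEBE.IsLipschitzOn T (CEBE.dom S A C))
    (hTlip₁ : CEBE.IsLipschitzOn (CEBE.partialC T) (CEBE.dom S A C))
    -- rewards
    (R : S × A × E → ℝ)
    (hRC2 : CEBE.IsC2InContext R C)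
    (hRbdd : CEBE.IsBoundedOn R (CEBE.dom S A C))
    (hRbdd₁ : CEBE.IsBoundedOn (CEBE.partialC R) (CEBE.dom S A C))
    (hRbdd₂ : CEBE.IsBoundedOn (CEBE.partialC (CEBE.partialC R)) (CEBE.dom S A C))
    (hRlip : CEBE.IsLipschitzOn R (CEBE.dom S A C))
    (hRlip₁ : CEBE.IsLipschitzOn (CEBE.partialC R) (CEBE.dom S A C))
    -- policy
    (π : S × E → ProbabilityMeasure A)
    (hπ : ∃ K : ℝ≥0, CEBE.PolicyLipschitzWith p C K π)
    -- contexts and discount factor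
    (c₀ c : E) (hc₀ : c₀ ∈ C) (hc : c ∈ C)
    (hclose : ENNReal.ofReal ‖c - c₀‖ <
      ENNReal.ofReal (CEBE.supNormOn (CEBE.partialC (CEBE.partialC T)) (CEBE.dom S A C))
        ^ (-(1 / 2) : ℝ))
    (γ : ℝ) (hγ₀ : 0 ≤ γ) (hγ₁ : γ < 1)
    (hγ : ENNReal.ofReal γ <
      1 / ENNReal.ofReal (4 * Metric.diam (univ : Set S) *
        (CEBE.lipConstOn T (CEBE.dom S A C) +
          ‖c - c₀‖ * CEBE.lipConstOn (CEBE.partialC T) (CEBE.dom S A C)) *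
        (1 + CEBE.policyLipConst p C π))) :
    -- the projection to the simplex is well defined on the linearized transitions
    (∀ z, 0 < (CEBE.linearize T c₀ c z).toJordanDecomposition.posPart univ) ∧
    -- both Bellman equations have exactly one solution among the bounded Lipschitz functions
    (∃! Q : S × A → ℝ,
      CEBE.IsQFunction γ (CEBE.slice R c) (CEBE.slice T c) (fun s => π (s, c)) Q) ∧
    (∃! Q : S × A → ℝ,
      CEBE.IsQFunction γ (CEBE.linearize R c₀ c)
        (fun z => CEBE.simplexProj (CEBE.linearize T c₀ c z)) (fun s => π (s, c)) Q) ∧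
    -- the error bound
    ∀ Qbe Qce : S × A → ℝ,
      CEBE.IsQFunction γ (CEBE.slice R c) (CEBE.slice T c) (fun s => π (s, c)) Qbe →
      CEBE.IsQFunction γ (CEBE.linearize R c₀ c)
        (fun z => CEBE.simplexProj (CEBE.linearize T c₀ c z)) (fun s => π (s, c)) Qce →
      CEBE.supNormOn (Qce - Qbe) univ ≤
        ‖c - c₀‖ ^ 2 / (1 - γ) *
          (CEBE.supNormOn (CEBE.partialC (CEBE.partialC R)) (CEBE.dom S A C) +
            3 * γ * Metric.diam (univ : Set S) * (1 + CEBE.policyLipConst p C π) *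
              CEBE.lipNormOn R (CEBE.dom S A C) *
              CEBE.supNormOn (CEBE.partialC (CEBE.partialC T)) (CEBE.dom S A C) /
            (1 - γ * max 1 (Metric.diam (univ : Set S) *
              CEBE.lipConstOn T (CEBE.dom S A C) * (1 + CEBE.policyLipConst p C π)))) := by
  obtain ⟨hpos, hbe, hce, herr⟩ := theorem3_general hCopen hp hTprob hTC2 hTbdd₂ hTlip hTlip₁ hRC2
    hRbdd hRbdd₂ hRlip hRlip₁ hπ (hCconv.segment_subset hc₀ hc) hγ₀ hγ₁
  refine ⟨hpos, hbe, hce, herr (CEBE.mul_lt_one_of_ofReal_lt_one_div hγ₀ ?_ hγ)⟩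
  gcongr
  · exact le_mul_of_one_le_left Metric.diam_nonneg (by norm_num)
  · exact le_add_of_nonneg_right (by positivity)
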